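/- Let $(X,\|\cdot\|)$ be a real normed space and let $\sigma$ be a Hausdorff topology on $X$, coarser than the norm topology, for which every homothety $x\mapsto cx$ ($c\in\mathbb R$) is continuous (for example a Hausdorff vector topology coarser than the norm topology). Assume that the closed unit ball $B_X$ is sequentially $\sigma$-compact (assumption $(H_\sigma)$) and $\sigma$-compact. Let $K\subseteq X$ be nonempty, $\sigma$-closed and convex, let $\psi:K\times K\to\mathbb R$, and write $\mathbb N=\{1,2,\dots\}$ and $K_n=\{x\in K:\|x\|\le n\}$. Notation. For $A\subseteq K$ put $S(\psi,A)=\{x\in A:\psi(x,y)\ge 0\ \ \forall y\in A\}$. For $A\subseteq X$ put $$A^\infty_\sigma=\Big\{u\in X:\ \exists\, t_k\to+\infty\ (t_k>0),\ (x_k)\subseteq A,\ \tfrac{x_k}{t_k}\xrightarrow{\sigma}u\Big\}.$$ For $f:K\to\mathbb R$ put $f^{\sigma g}(u)=\inf\{\lambda\in\mathbb R: u\in(\{x\in K:f(x)\le\lambda\})^\infty_\sigma\}\in[-\infty,+\infty]$ for $u\in X$, and let $$R^E_\sigma=\{u\in K^\infty_\sigma:\ (-\psi(\cdot,y))^{\sigma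 g}(u)\le 0\ \ \forall y\in K\}.$$ Assume: * $(K_\sigma)$: for every unbounded sequence $(x_n)_{n\in\mathbb N}$ in $X$ such that $x_n\in S(\psi,K_n)$ for every $n\in\mathbb N$ with $K_n\neq\emptyset$, there exist a subsequence $(x_{n_k})$, a sequence $(w_k)\subseteq K\setminus\{0\}$ and $0\ne d\in K^\infty_\sigma$ such that $\frac{w_k}{\|w_k\|}\xrightarrow{\sigma}d$ and, for each $k$, $\psi(x_{n_k},y)\le\psi(w_k,y)$ for all $y\in K_{n_k}$; * for each $n\in\mathbb N$, $\psi$ is $\sigma$-transfer upper semicontinuous ($\sigma$-tusc) on $K_n$: whenever $x_0,y\in K_n$ and $\psi(x_0,y)<0$, there are $y'\in K_n$ and a $\sigma$-neighbourhood $V$ of $x_0$ relative to $K_n$ with $\psi(x,y')<0$ for all $x\in V$; * $R^E_\sigma\subseteq\{0\}$. Then $S(\psi,K)$ is nonempty and $(S(\psi,K))^\infty_\sigma=\{0\}$, provided at least one of the following holds. 1. For each $n\in\mathbb N$, $\psi|_{K_n\times K_n}$ is anti-locally dominated in $y$: for every nonempty finite $\{y_1,\dots,y_m\}\subseteq K_n$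 there is $x\in K_n$ with $\psi(x,y_i)\ge 0$ for all $i$. 2. For each $n\in\mathbb N$, $\psi|_{K_n\times K_n}$ is transfer quasi-convex in $y$: for every finite $\{y_1,\dots,y_m\}\subseteq K_n$ there are $x_1,\dots,x_m\in K_n$ such that for every $L\subseteq\{1,\dots,m\}$ and $x\in\mathrm{co}\{x_i:i\in L\}$ one has $\psi(x,y_i)\ge0$ for some $i\in L$. 3. $\psi$ is cyclically anti-quasimonotone: for all $m\ge1$ and $x_1,\dots,x_m\in K$ there is $i$ with $\psi(x_i,x_{i+1})\ge0$, where $x_{m+1}:=x_1$. 4. For every $x\in K$, $\psi(x,\cdot)$ is quasi-convex and $\psi(x,x)\ge0$. 5. $-\psi$ is pseudomonotone (for all $x,y\in K$, $-\psi(x,y)\ge0$ implies $-\psi(y,x)\le0$), for every $y\in K$ the function $\psi(\cdot,y)$ is quasi-concave, and $\psi(x,x)=0$ for every $x\in K$. -/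

import Mathlib

open Filter Topology

namespace EquilibriumProblem

section Basic

variable {X : Type*}

/-- Solution set `S(ψ, K)` of the equilibrium problem. A bifunction `K × K → ℝ` is represented by
`ψ : X → X → ℝ`, of which only the values on `K × K` are used. -/
def solutionSet (ψ : X → X → ℝ) (K : Set X) : Set X :=
  {x | x ∈ K ∧ ∀ y ∈ K, 0 ≤ ψ x y}

/-- `ψ : K × Y → ℝ` is `σ`-transfer lower semicontinuous in `x₀` with respect to `Y`
(neighbourhoods of `x₀` are those of the subspace `K` of `(X, σ)`). -/
def TransferLSCAt (σ : TopologicalSpace X) (K Y : Set X) (ψ : X → X → ℝ) (x₀ : X) : Prop :=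
  ∀ y ∈ Y, 0 < ψ x₀ y → ∃ y' ∈ Y, ∀ᶠ x in @nhdsWithin X σ x₀ K, 0 < ψ x y'

/-- `ψ : K × K → ℝ` is `σ`-transfer lower semicontinuous on `K`. -/
def TransferLSCOn (σ : TopologicalSpace X) (K : Set X) (ψ : X → X → ℝ) : Prop :=
  ∀ x₀ ∈ K, TransferLSCAt σ K K ψ x₀

/-- `ψ : K × K → ℝ` is `σ`-transfer upper semicontinuous on `K`. -/
def TransferUSCOn (σ : TopologicalSpace X) (K : Set X) (ψ : X → X → ℝ) : Prop :=
  TransferLSCOn σ K (-ψ)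

/-- `ψ : K × Y → ℝ` is locally dominated in `y`. -/
def LocallyDominated (K Y : Set X) (ψ : X → X → ℝ) : Prop :=
  ∀ s : Finset X, s.Nonempty → (s : Set X) ⊆ Y → ∃ x ∈ K, ∀ y ∈ s, ψ x y ≤ 0

/-- `ψ : K × Y → ℝ` is anti-locally dominated in `y`. -/
def AntiLocallyDominated (K Y : Set X) (ψ : X → X → ℝ) : Prop :=
  LocallyDominated K Y (-ψ)

/-- `ψ` is pseudomonotone on `K`. -/
def Pseudomonotone (K : Set X) (ψ : X → X → ℝ) : Prop :=
  ∀ x ∈ K, ∀ y ∈ K, 0 ≤ ψ x y → ψ y x ≤ 0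

/-- `ψ` is cyclically anti-quasimonotone on `K`: for all `x₀, …, xₘ ∈ K` there is `i` with
`ψ xᵢ xᵢ₊₁ ≥ 0`, where `i + 1` is taken cyclically in `Fin (m + 1)`. -/
def CyclicallyAntiQuasimonotone (K : Set X) (ψ : X → X → ℝ) : Prop :=
  ∀ (m : ℕ) (x : Fin (m + 1) → X), (∀ i, x i ∈ K) → ∃ i, 0 ≤ ψ (x i) (x (i + 1))

end Basic

section Normed

variable {X : Type*} [NormedAddCommGroup X] [NormedSpace ℝ X]

/-- `K_n`, the set of points of `K` of norm at most `n`. -/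
def trunc (K : Set X) (n : ℕ) : Set X := {x | x ∈ K ∧ ‖x‖ ≤ n}

/-- `ψ : K × Y → ℝ`, with `K` convex, is transfer quasi-concave in `y`. -/
def TransferQuasiconcave (K Y : Set X) (ψ : X → X → ℝ) : Prop :=
  ∀ (m : ℕ) (y : Fin m → X), (∀ i, y i ∈ Y) →
    ∃ x : Fin m → X, (∀ i, x i ∈ K) ∧
      ∀ L : Finset (Fin m), ∀ z ∈ convexHull ℝ (x '' (L : Set (Fin m))), ∃ i ∈ L, ψ z (y i) ≤ 0

/-- `ψ : K × Y → ℝ`, with `K` convex, is transfer quasi-convex in `y`. -/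
def TransferQuasiconvex (K Y : Set X) (ψ : X → X → ℝ) : Prop :=
  TransferQuasiconcave K Y (-ψ)

/-- The (sequential) `σ`-asymptotic cone of `A`. -/
def asympCone (σ : TopologicalSpace X) (A : Set X) : Set X :=
  {u | ∃ (t : ℕ → ℝ) (x : ℕ → X), (∀ k, 0 < t k) ∧ Tendsto t atTop atTop ∧ (∀ k, x k ∈ A) ∧
    Tendsto (fun k => (t k)⁻¹ • x k) atTop (@nhds X σ u)}

open Classical in
/-- The extension of `f : K → ℝ` to `X` by `+∞`. -/
noncomputable def extendTop (K : Set X) (f : X → ℝ) : X → EReal :=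
  fun x => if x ∈ K then (f x : EReal) else ⊤

/-- The `σ`-generalized asymptotic function `f^{σg}`, the infimum being over real `lam`. -/
noncomputable def genAsympFun (σ : TopologicalSpace X) (f : X → EReal) (u : X) : EReal :=
  ⨅ (lam : ℝ) (_ : u ∈ asympCone σ {x | f x ≤ (lam : EReal)}), (lam : EReal)

/-- The set `R_σ^E` of `u ∈ K_σ^∞` with `(-ψ(·, y))^{σg}(u) ≤ 0` for all `y ∈ K`. -/
def RSet (σ : TopologicalSpace X) (K : Set X) (ψ : X → X → ℝ) : Set X :=
  {u | u ∈ asympCone σ K ∧ ∀ y ∈ K, genAsympFun σ (extendTop K fun x => -ψ x y) u ≤ 0}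

/-- Condition `(K_σ)`. Membership `x n ∈ S(ψ, K_n)` is asked for all `n ≥ 1` with `K_n` nonempty
(for all `n ≥ 1` as soon as `K` meets the unit ball); finitely many terms are thus left free. -/
def ConditionK (σ : TopologicalSpace X) (K : Set X) (ψ : X → X → ℝ) : Prop :=
  ∀ x : ℕ → X, (∀ n, 1 ≤ n → (trunc K n).Nonempty → x n ∈ solutionSet ψ (trunc K n)) →
    (∀ C : ℝ, ∃ n, C < ‖x n‖) →
    ∃ (φ : ℕ → ℕ) (w : ℕ → X) (d : X), StrictMono φ ∧ (∀ k, 1 ≤ φ k) ∧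
      (∀ k, w k ∈ K ∧ w k ≠ 0) ∧ d ≠ 0 ∧ d ∈ asympCone σ K ∧
      (∀ k, ∀ y ∈ trunc K (φ k), ψ (x (φ k)) y ≤ ψ (w k) y) ∧
      Tendsto (fun k => ‖w k‖⁻¹ • w k) atTop (@nhds X σ d)

/-- Assumption `(H_σ)`: the closed unit ball is sequentially `σ`-compact. -/
def AssumptionH (X : Type*) [NormedAddCommGroup X] (σ : TopologicalSpace X) : Prop :=
  @IsSeqCompact X σ (Metric.closedBall (0 : X) 1)

end Normed

end EquilibriumProblem

/-!
The problem is solved first on the `σ`-compact truncations `K_n`, and the solutions `x_n` found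
there are then shown to lead to a solution on `K`.

On `K_n`, transfer upper semicontinuity says that the sets `{ψ (·, y) ≥ 0}` have the same
intersection as their `σ`-closures, so by compactness only finitely many `y` have to be treated at
a time (`nonempty_solutionSet_of_isCompact`). Anti-local domination is exactly what this asks for,
and cyclic anti-quasimonotonicity implies it: otherwise negative values of `ψ` could be followed
along a finite set until they close up to a cycle. Under transfer quasi-convexity, which both
convexity conditions imply, it is the theorem of Knaster, Kuratowski and Mazurkiewicz
(`nonempty_iInter_of_convexHull_subset`), applied to the norm topology, in which `σ`-closed sets
are closed.

This theorem is deduced from Brouwer's fixed point theorem on the simplex. Brouwer's theorem in turn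
rests on a purely order-theoretic version of Sperner's lemma due to Scarf
(`exists_dominant_rainbow`): subsets of a finite set with several linear orders play the role of the
cells of a triangulation, and a parity count of doors produces a cell of all colours. For the points
of a grid, ordered by their coordinates, such a cell is small (`exists_grid_point`).

For the passage to `K` (`nonempty_solutionSet_of_trunc`), a `σ`-cluster point of a bounded
subsequence of `x_n` is a solution, again by transfer upper semicontinuity. If `x_n` is unbounded,
condition `(K_σ)` provides points `w_k` that do at least as well as a subsequence of `x_n`, with
directions tending to some `d ≠ 0`. If `‖w_k‖ → ∞`, then `d` belongs to `R_σ^E`, which is excluded;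
otherwise the `w_k` have a bounded subsequence and the same cluster point argument applies.
Finally, the asymptotic cone of the solution set is always contained in `R_σ^E`.
-/

namespace EquilibriumProblem

/-! ### Dominant sets and door counting -/

section Dominant

variable {V I α : Type*} [LinearOrder α]

/-- A set `U` is dominant for the preorders pulled back along `r i : V → α` if no element of `V` is
strictly above the `i`-minimum of `U` for every index `i`. For injective `r i` a dominant set has at
most `|I|` points; those with `|I|` points play the role of the cells of a triangulation and those
with `|I| - 1` points that of the walls between cells. A wall with the colours `I \ {i₀}` is called
a door. -/
def Dominant (r : I → V → α) (U : Finset V) : Prop :=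
  ∀ y, ∃ i, ∀ u ∈ U, r i y ≤ r i u

theorem Dominant.mono {r : I → V → α} {F U : Finset V} (hU : Dominant r U) (h : F ⊆ U) :
    Dominant r F := fun y => (hU y).imp fun _ hi u hu => hi u (h hu)

theorem exists_isLeast_index (r : I → V → α) {F : Finset V} (hF : F.Nonempty) :
    ∃ m : I → V, ∀ i, m i ∈ F ∧ ∀ u ∈ F, r i (m i) ≤ r i u := by
  choose m hm using fun i => F.exists_min_image (r i) hF
  exact ⟨m, hm⟩

theorem Dominant.exists_eq_min {r : I → V → α} (hr : ∀ i, Function.Injective (r i))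
    {F : Finset V} (hF : Dominant r F) {m : I → V}
    (hm : ∀ i, m i ∈ F ∧ ∀ u ∈ F, r i (m i) ≤ r i u) {y : V} (hy : y ∈ F) : ∃ i, m i = y := by
  obtain ⟨i, hi⟩ := hF y
  exact ⟨i, hr i (le_antisymm ((hm i).2 y hy) (hi _ (hm i).1))⟩

variable [DecidableEq V] [Fintype I]

/-- A set of `|I|` points that does not show all colours has no doors or exactly two of them: if
removing `u₁` leaves the colours `I \ {i₀}`, then one other point repeats the colour of `u₁`, and
only that point can be removed instead. -/
theorem even_card_doors_of_cell [DecidableEq I] (c : V → I) (i₀ : I) {U : Finset V}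
    (hcard : U.card = Fintype.card I) (hU : U.image c ≠ Finset.univ) :
    Even (((U.powersetCard (Fintype.card I - 1)).filter
      fun F => F.image c = Finset.univ.erase i₀)).card := by
  classical
  have hpos : 0 < Fintype.card I := Fintype.card_pos_iff.2 ⟨i₀⟩
  rcases Finset.eq_empty_or_nonempty ((U.powersetCard (Fintype.card I - 1)).filter
      fun F => F.image c = Finset.univ.erase i₀) with h0 | ⟨F, hF⟩
  · rw [h0]; simp
  obtain ⟨hFU, hFc⟩ := Finset.mem_filter.1 hF
  obtain ⟨hFU, hFcard⟩ := Finset.mem_powersetCard.1 hFU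
  have hF_inj : Set.InjOn c F := by
    apply Finset.card_image_iff.1
    rw [hFc, hFcard, Finset.card_erase_of_mem (Finset.mem_univ _), Finset.card_univ]
  -- A point whose colour is `i₀` would complete the colours of `F` to all of `I`.
  have hne : ∀ u ∈ U, c u ≠ i₀ := by
    intro u hu hui
    apply hU
    rw [Finset.eq_univ_iff_forall]
    intro i
    by_cases hi : i = i₀
    · exact Finset.mem_image.2 ⟨u, hu, by rw [hui, hi]⟩
    · have : i ∈ F.image c := by rw [hFc]; simp [hi]
      exact Finset.image_subset_image hFU this
  obtain ⟨u₁, hu₁⟩ : ∃ u, U \ F = {u} := by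
    rw [← Finset.card_eq_one, Finset.card_sdiff_of_subset hFU]; omega
  have hu₁U : u₁ ∈ U ∧ u₁ ∉ F := by
    have : u₁ ∈ U \ F := by rw [hu₁]; simp
    simpa using this
  have hUF : ∀ u ∈ U, u = u₁ ∨ u ∈ F := by
    intro u hu
    by_cases h : u ∈ F
    · exact Or.inr h
    · have : u ∈ U \ F := by simp [hu, h]
      rw [hu₁] at this
      exact Or.inl (by simpa using this)
  obtain ⟨u₂, hu₂, hcu⟩ : ∃ u ∈ F, c u = c u₁ := by
    have : c u₁ ∈ F.image c := by rw [hFc]; simp [hne u₁ hu₁U.1]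
    simpa using this
  have h12 : u₂ ≠ u₁ := fun h => hu₁U.2 (h ▸ hu₂)
  have key : ((U.powersetCard (Fintype.card I - 1)).filter
      fun F => F.image c = Finset.univ.erase i₀) = {U.erase u₁, U.erase u₂} := by
    ext G
    simp only [Finset.mem_filter, Finset.mem_powersetCard, Finset.mem_insert,
      Finset.mem_singleton]
    constructor
    · rintro ⟨⟨hGU, hGcard⟩, hGc⟩
      obtain ⟨u, hu⟩ : ∃ u, U \ G = {u} := by
        rw [← Finset.card_eq_one, Finset.card_sdiff_of_subset hGU]; omega
      have huU : u ∈ U ∧ u ∉ G := by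
        have : u ∈ U \ G := by rw [hu]; simp
        simpa using this
      have hG : G = U.erase u := by
        rw [Finset.erase_eq, ← hu, Finset.sdiff_sdiff_eq_self hGU]
      obtain ⟨u', hu', hcu'⟩ : ∃ u' ∈ G, c u' = c u := by
        have : c u ∈ G.image c := by rw [hGc]; simp [hne u huU.1]
        simpa using this
      have huu' : u' ≠ u := fun h => huU.2 (h ▸ hu')
      rcases hUF u huU.1 with rfl | huF
      · exact Or.inl hG
      · rcases hUF u' (hGU hu') with rfl | hu'F
        · rw [hF_inj hu₂ huF (hcu.trans hcu')]
          exact Or.inr hG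
        · exact absurd (hF_inj hu'F huF hcu') huu'
    · have him : ∀ u v, u ∈ U → v ∈ U → u ≠ v → c u = c v →
          (U.erase u).image c = U.image c := by
        intro u v hu hv huv h
        apply (Finset.image_subset_image (Finset.erase_subset _ _)).antisymm
        intro i hi
        obtain ⟨w, hw, rfl⟩ := Finset.mem_image.1 hi
        by_cases hwu : w = u
        · exact Finset.mem_image.2 ⟨v, by simp [hv, huv.symm], by rw [hwu, h]⟩
        · exact Finset.mem_image.2 ⟨w, by simp [hw, hwu], rfl⟩
      have hF1 : U.erase u₁ = F := by
        rw [Finset.erase_eq, ← hu₁, Finset.sdiff_sdiff_eq_self hFU]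
      have e1 := him u₁ u₂ hu₁U.1 (hFU hu₂) h12.symm hcu.symm
      have e2 := him u₂ u₁ (hFU hu₂) hu₁U.1 h12 hcu
      rintro (rfl | rfl)
      · exact ⟨⟨Finset.erase_subset _ _, by rw [hF1, hFcard]⟩, by rw [hF1, hFc]⟩
      · refine ⟨⟨Finset.erase_subset _ _, ?_⟩, ?_⟩
        · rw [Finset.card_erase_of_mem (hFU hu₂), hcard]
        · rw [e2, ← e1, hF1, hFc]
  rw [key, Finset.card_pair]
  · exact even_two
  · intro h
    have : u₂ ∈ U.erase u₁ := by simp [h12, hFU hu₂]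
    rw [h] at this
    simp at this

variable [Fintype V]

/-- If every point of a dominant set `F` is a minimum for some index other than `k`, and some
point lies above these minima, then the `k`-largest such point can be added to `F`. -/
theorem Dominant.exists_insert {r : I → V → α}
    {F : Finset V} (hF : Dominant r F) {m : I → V}
    (hm : ∀ i, m i ∈ F ∧ ∀ u ∈ F, r i (m i) ≤ r i u) {k : I}
    (hk : ∀ y ∈ F, ∃ l, l ≠ k ∧ m l = y) (hne : ∃ y, ∀ l, l ≠ k → r l (m l) < r l y) :
    ∃ x, x ∉ F ∧ Dominant r (insert x F) ∧ (∀ l, l ≠ k → r l (m l) < r l x) ∧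
      ∀ y, (∀ l, l ≠ k → r l (m l) < r l y) → r k y ≤ r k x := by
  classical
  obtain ⟨x, hx, hmax⟩ := (Finset.univ.filter fun y =>
    ∀ l, l ≠ k → r l (m l) < r l y).exists_max_image (r k) (by obtain ⟨y, hy⟩ := hne; exact ⟨y, by simpa using hy⟩)
  simp only [Finset.mem_filter, Finset.mem_univ, true_and] at hx hmax
  have hxF : x ∉ F := by
    intro h
    obtain ⟨l, hl, rfl⟩ := hk x h
    exact lt_irrefl _ (hx l hl)
  refine ⟨x, hxF, ?_, hx, hmax⟩
  have hkx : r k x ≤ r k (m k) := by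
    obtain ⟨i, hi⟩ := hF x
    by_cases hik : i = k
    · subst hik; exact hi _ (hm i).1
    · exact absurd (hi _ (hm i).1) (not_le.2 (hx i hik))
  intro y
  by_cases hy : ∀ l, l ≠ k → r l (m l) < r l y
  · refine ⟨k, fun u hu => ?_⟩
    rcases Finset.mem_insert.1 hu with rfl | hu
    · exact hmax y hy
    · exact (hmax y hy).trans (hkx.trans ((hm k).2 u hu))
  · push Not at hy
    obtain ⟨l, hl, hyl⟩ := hy
    refine ⟨l, fun u hu => ?_⟩
    rcases Finset.mem_insert.1 hu with rfl | hu
    · exact hyl.trans (hx l hl).le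
    · exact hyl.trans ((hm l).2 u hu)

/-- A wall with a point that is not slack lies in exactly two cells. Exactly two of the `|I|`
indices have the same minimum on the wall, and each of them accounts for one cell. -/
theorem card_cells_of_interior_wall {r : I → V → α} (hr : ∀ i, Function.Injective (r i))
    {s : I → V} (hhigh : ∀ i j v, i ≠ j → v ∉ Set.range s → r i v < r i (s j))
    {F : Finset V} (hF : Dominant r F) (hcard : F.card + 1 = Fintype.card I)
    {v : V} (hvF : v ∈ F) (hv : v ∉ Set.range s) [DecidablePred (Dominant r)] :
    (Finset.univ.filter fun U : Finset V =>
      (Dominant r U ∧ U.card = Fintype.card I) ∧ F ⊆ U).card = 2 := by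
  classical
  obtain ⟨m, hm⟩ := exists_isLeast_index r ⟨v, hvF⟩
  obtain ⟨i, -, j, -, hij, hmij⟩ : ∃ i ∈ Finset.univ, ∃ j ∈ Finset.univ, i ≠ j ∧ m i = m j :=
    Finset.exists_ne_map_eq_of_card_lt_of_maps_to (t := F)
      (by rw [Finset.card_univ]; omega) (fun i _ => (hm i).1)
  have hi : ∀ y ∈ F, ∃ l, l ≠ i ∧ m l = y := by
    intro y hy
    obtain ⟨l, rfl⟩ := hF.exists_eq_min hr hm hy
    by_cases h : l = i
    · exact ⟨j, hij.symm, by rw [h, hmij]⟩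
    · exact ⟨l, h, rfl⟩
  have hj : ∀ y ∈ F, ∃ l, l ≠ j ∧ m l = y := by
    intro y hy
    obtain ⟨l, rfl⟩ := hF.exists_eq_min hr hm hy
    by_cases h : l = j
    · exact ⟨i, hij, by rw [h, hmij]⟩
    · exact ⟨l, h, rfl⟩
  -- The slack element of index `k` is above all minima of index `l ≠ k`.
  have hslack : ∀ k, ∃ y, ∀ l, l ≠ k → r l (m l) < r l y := fun k =>
    ⟨s k, fun l hl => ((hm l).2 v hvF).trans_lt (hhigh l k v hl hv)⟩
  obtain ⟨a, haF, had, ha, hamax⟩ := hF.exists_insert hm hi (hslack i)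
  obtain ⟨b, hbF, hbd, hb, hbmax⟩ := hF.exists_insert hm hj (hslack j)
  have hab : a ≠ b := by
    rintro rfl
    obtain ⟨l, hl⟩ := hF a
    have := hl _ (hm l).1
    by_cases h : l = i
    · exact absurd this (not_le.2 (hb l (h ▸ hij)))
    · exact absurd this (not_le.2 (ha l h))
  have key : (Finset.univ.filter fun U : Finset V =>
      (Dominant r U ∧ U.card = Fintype.card I) ∧ F ⊆ U) = {insert a F, insert b F} := by
    ext U
    simp only [Finset.mem_filter, Finset.mem_univ, true_and, Finset.mem_insert,
      Finset.mem_singleton]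
    constructor
    · rintro ⟨⟨hU, hUc⟩, hFU⟩
      obtain ⟨x, hx⟩ : ∃ x, U \ F = {x} := by
        rw [← Finset.card_eq_one, Finset.card_sdiff_of_subset hFU]; omega
      have hxU : x ∈ U ∧ x ∉ F := by
        have : x ∈ U \ F := by rw [hx]; simp
        simpa using this
      have hUx : U = insert x F := by
        rw [Finset.insert_eq, ← hx, Finset.sdiff_union_of_subset hFU]
      obtain ⟨m', hm'⟩ := exists_isLeast_index r ⟨x, hxU.1⟩
      have hm'_inj : Function.Injective m' := by
        have himage : Finset.univ.image m' = U := by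
          apply Finset.Subset.antisymm
          · intro y hy
            obtain ⟨l, -, rfl⟩ := Finset.mem_image.1 hy
            exact (hm' l).1
          · intro y hy
            obtain ⟨l, rfl⟩ := hU.exists_eq_min hr hm' hy
            simp
        have := (Finset.card_image_iff (s := Finset.univ) (f := m')).1
          (by rw [himage, hUc, Finset.card_univ])
        simpa [Set.injOn_univ] using this
      obtain ⟨k, rfl⟩ := hU.exists_eq_min hr hm' hxU.1
      have hmm' : ∀ l, l ≠ k → m' l = m l := by
        intro l hl
        have hlF : m' l ∈ F := by
          have := (hm' l).1
          rw [hUx, Finset.mem_insert] at this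
          exact this.resolve_left fun h => hl (hm'_inj h)
        exact hr l (le_antisymm ((hm' l).2 _ (hFU (hm l).1)) ((hm l).2 _ hlF))
      have hM : ∀ l, l ≠ k → r l (m l) < r l (m' k) := by
        intro l hl
        rw [← hmm' l hl]
        exact lt_of_le_of_ne ((hm' l).2 _ hxU.1) fun h => hl (hm'_inj (hr l h))
      -- A point above the minima of `F` for the indices `≠ k` cannot be `k`-above `m' k`.
      have hle : ∀ y, (∀ l, l ≠ k → r l (m l) < r l y) → r k y ≤ r k (m' k) := by
        intro y hy
        obtain ⟨l, hl⟩ := hU y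
        by_cases hlk : l = k
        · subst hlk; exact hl _ hxU.1
        · exact absurd (hl _ (hFU (hm l).1)) (not_le.2 (hy l hlk))
      have hk : k = i ∨ k = j := by
        by_contra h
        push Not at h
        exact hij (hm'_inj (by rw [hmm' i h.1.symm, hmm' j h.2.symm, hmij]))
      rcases hk with rfl | rfl
      · left
        rw [hUx, hr k (le_antisymm (hamax _ hM) (hle a ha))]
      · right
        rw [hUx, hr k (le_antisymm (hbmax _ hM) (hle b hb))]
    · rintro (rfl | rfl)
      · exact ⟨⟨had, by rw [Finset.card_insert_of_notMem haF, hcard]⟩, Finset.subset_insert _ _⟩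
      · exact ⟨⟨hbd, by rw [Finset.card_insert_of_notMem hbF, hcard]⟩, Finset.subset_insert _ _⟩
  rw [key, Finset.card_pair]
  intro h
  have : a ∈ insert b F := h ▸ Finset.mem_insert_self a F
  rcases Finset.mem_insert.1 this with h | h
  · exact hab h
  · exact haF h

variable [DecidableEq I]

/-- The wall consisting of all slack elements but `s i₀` lies in exactly one cell, obtained by adding
the `i₀`-largest point that is not slack. -/
theorem card_cells_of_boundary_wall {r : I → V → α} (hr : ∀ i, Function.Injective (r i))
    {s : I → V} (hs : Function.Injective s) (hlow : ∀ i v, r i (s i) ≤ r i v)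
    (hhigh : ∀ i j v, i ≠ j → v ∉ Set.range s → r i v < r i (s j))
    (hV : ∃ v, v ∉ Set.range s) (i₀ : I) [DecidablePred (Dominant r)] :
    (Finset.univ.filter fun U : Finset V =>
      (Dominant r U ∧ U.card = Fintype.card I) ∧ (Finset.univ.erase i₀).image s ⊆ U).card = 1 := by
  classical
  have hpos : 0 < Fintype.card I := Fintype.card_pos_iff.2 ⟨i₀⟩
  have hcard : ((Finset.univ.erase i₀).image s).card = Fintype.card I - 1 := by
    rw [Finset.card_image_of_injective _ hs, Finset.card_erase_of_mem (Finset.mem_univ _),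
      Finset.card_univ]
  obtain ⟨a, ha, hamax⟩ := (Finset.univ.filter fun y => y ∉ Set.range s).exists_max_image
    (r i₀) (by obtain ⟨y, hy⟩ := hV; exact ⟨y, by simpa using hy⟩)
  replace ha : a ∉ Set.range s := by simpa using ha
  replace hamax : ∀ y, y ∉ Set.range s → r i₀ y ≤ r i₀ a := fun y hy =>
    hamax y (by simpa using hy)
  have haF : a ∉ (Finset.univ.erase i₀).image s := by
    intro h
    obtain ⟨l, -, rfl⟩ := Finset.mem_image.1 h
    exact ha ⟨l, rfl⟩
  rw [Finset.card_eq_one]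
  refine ⟨insert a ((Finset.univ.erase i₀).image s), ?_⟩
  ext U
  simp only [Finset.mem_filter, Finset.mem_univ, true_and, Finset.mem_singleton]
  constructor
  · rintro ⟨⟨hU, hUc⟩, hFU⟩
    obtain ⟨x, hx⟩ : ∃ x, U \ (Finset.univ.erase i₀).image s = {x} := by
      rw [← Finset.card_eq_one, Finset.card_sdiff_of_subset hFU]; omega
    have hxU : x ∈ U := by
      have : x ∈ U \ (Finset.univ.erase i₀).image s := by rw [hx]; simp
      exact (Finset.mem_sdiff.1 this).1
    have hUx : U = insert x ((Finset.univ.erase i₀).image s) := by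
      rw [Finset.insert_eq, ← hx, Finset.sdiff_union_of_subset hFU]
    -- The index witnessing dominance at a non-slack point must be `i₀`, for otherwise the
    -- point would be below a slack element of its own index.
    have hdom : ∀ y, y ∉ Set.range s → ∀ u ∈ U, r i₀ y ≤ r i₀ u := by
      intro y hy
      obtain ⟨l, hl⟩ := hU y
      by_cases h : l = i₀
      · exact h ▸ hl
      · have hsl : s l ∈ U := hFU (Finset.mem_image.2 ⟨l, by simp [h], rfl⟩)
        exact absurd ⟨l, hr l (le_antisymm (hlow l y) (hl _ hsl))⟩ hy
    have hxs : x ∉ Set.range s := by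
      rintro ⟨l, rfl⟩
      by_cases h : l = i₀
      · subst h
        exact ha ⟨l, hr l (le_antisymm (hlow l a) (hdom a ha _ hxU))⟩
      · have : s l ∈ U \ (Finset.univ.erase i₀).image s := by rw [hx]; simp
        exact (Finset.mem_sdiff.1 this).2 (Finset.mem_image.2 ⟨l, by simp [h], rfl⟩)
    rw [hUx, hr i₀ (le_antisymm (hamax x hxs) (hdom a ha x hxU))]
  · rintro rfl
    refine ⟨⟨fun y => ?_, by rw [Finset.card_insert_of_notMem haF, hcard]; omega⟩,
      Finset.subset_insert _ _⟩
    by_cases hy : y ∈ Set.range s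
    · obtain ⟨l, rfl⟩ := hy
      exact ⟨l, fun u _ => hlow l u⟩
    · refine ⟨i₀, fun u hu => ?_⟩
      rcases Finset.mem_insert.1 hu with rfl | hu
      · exact hamax y hy
      · obtain ⟨l, hl, rfl⟩ := Finset.mem_image.1 hu
        exact (hhigh i₀ l y (by simpa [eq_comm] using hl) hy).le

/-- Sperner's lemma in Scarf's order-theoretic form. The slack elements `s i` stand for
the sides of the simplex. If no cell showed all colours, counting the pairs of a door and a cell
containing it would give an even number by cells, but an odd number by doors, since all doors except
the one of slack elements lie in two cells. -/
theorem exists_dominant_rainbow {r : I → V → α} (hr : ∀ i, Function.Injective (r i))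
    {s : I → V} (c : V → I) (hcs : ∀ i, c (s i) = i) (hlow : ∀ i v, r i (s i) ≤ r i v)
    (hhigh : ∀ i j v, i ≠ j → v ∉ Set.range s → r i v < r i (s j))
    (hV : ∃ v, v ∉ Set.range s) : ∃ U, Dominant r U ∧ ∀ i, ∃ u ∈ U, c u = i := by
  classical
  by_contra hcon
  push Not at hcon
  have hs : Function.Injective s := fun i j h => by rw [← hcs i, ← hcs j, h]
  obtain ⟨v₀, hv₀⟩ := hV
  set i₀ := c v₀
  have hpos : 0 < Fintype.card I := Fintype.card_pos_iff.2 ⟨i₀⟩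
  set doors : Finset (Finset V) := Finset.univ.filter fun F =>
    Dominant r F ∧ F.card + 1 = Fintype.card I ∧ F.image c = Finset.univ.erase i₀ with hdoors
  set cells : Finset (Finset V) := Finset.univ.filter fun U =>
    Dominant r U ∧ U.card = Fintype.card I with hcells
  set F₀ := (Finset.univ.erase i₀).image s with hF₀
  have hcount := Finset.sum_card_bipartiteAbove_eq_sum_card_bipartiteBelow (s := doors)
    (t := cells) (fun F U => F ⊆ U)
  have hright : Even (∑ U ∈ cells, (doors.bipartiteBelow (fun F U => F ⊆ U) U).card) := by
    refine Finset.even_sum _ fun U hU => ?_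
    obtain ⟨hU, hUc⟩ := (Finset.mem_filter.1 hU).2
    have hne : U.image c ≠ Finset.univ := by
      obtain ⟨i, hi⟩ := hcon U hU
      intro h
      have : i ∈ U.image c := by rw [h]; simp
      obtain ⟨u, hu, hui⟩ := Finset.mem_image.1 this
      exact hi u hu hui
    suffices hbelow : doors.bipartiteBelow (fun F U => F ⊆ U) U =
        (U.powersetCard (Fintype.card I - 1)).filter
          fun F => F.image c = Finset.univ.erase i₀ by
      rw [hbelow]
      exact even_card_doors_of_cell c i₀ hUc hne
    ext F
    simp only [Finset.bipartiteBelow, hdoors, Finset.mem_filter, Finset.mem_univ, true_and,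
      Finset.mem_powersetCard]
    constructor
    · rintro ⟨⟨-, h1, h2⟩, h3⟩
      exact ⟨⟨h3, by omega⟩, h2⟩
    · rintro ⟨⟨h3, h1⟩, h2⟩
      exact ⟨⟨hU.mono h3, by omega, h2⟩, h3⟩
  have hleft_eq : ∀ F, cells.bipartiteAbove (fun F U => F ⊆ U) F =
      Finset.univ.filter fun U : Finset V =>
        (Dominant r U ∧ U.card = Fintype.card I) ∧ F ⊆ U := by
    intro F
    ext U
    simp [Finset.bipartiteAbove, hcells]
  have hone := card_cells_of_boundary_wall hr hs hlow hhigh ⟨v₀, hv₀⟩ i₀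
  have hF₀mem : F₀ ∈ doors := by
    obtain ⟨U, hU⟩ := Finset.card_pos.1 (hone ▸ Nat.one_pos)
    obtain ⟨⟨hU, -⟩, hFU⟩ := (Finset.mem_filter.1 hU).2
    refine Finset.mem_filter.2 ⟨Finset.mem_univ _, hU.mono hFU, ?_, ?_⟩
    · rw [hF₀, Finset.card_image_of_injective _ hs,
        Finset.card_erase_of_mem (Finset.mem_univ _), Finset.card_univ]
      omega
    · rw [hF₀, Finset.image_image]
      have : c ∘ s = id := funext hcs
      rw [this, Finset.image_id]
  have hleft : Odd (∑ F ∈ doors, (cells.bipartiteAbove (fun F U => F ⊆ U) F).card) := by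
    rw [← Finset.add_sum_erase _ _ hF₀mem, hleft_eq F₀, hone]
    refine Even.one_add (Finset.even_sum _ fun F hF => ?_)
    obtain ⟨hFne, hF⟩ := Finset.mem_erase.1 hF
    obtain ⟨-, hFd, hFcard, hFc⟩ := Finset.mem_filter.1 hF
    -- A door of slack elements only is determined by its colours.
    obtain ⟨v, hvF, hv⟩ : ∃ v ∈ F, v ∉ Set.range s := by
      by_contra h
      push Not at h
      apply hFne
      rw [hF₀, ← hFc, Finset.image_image]
      ext v
      simp only [Finset.mem_image, Function.comp]
      constructor
      · intro hv
        obtain ⟨l, rfl⟩ := h v hv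
        exact ⟨s l, hv, by rw [hcs]⟩
      · rintro ⟨w, hw, rfl⟩
        obtain ⟨l, rfl⟩ := h w hw
        rwa [hcs]
    rw [hleft_eq F, card_cells_of_interior_wall hr hhigh hFd hFcard hvF hv]
    exact even_two
  rw [hcount] at hleft
  exact (Nat.not_even_iff_odd.2 hleft) hright

end Dominant

/-! ### Labelled grids in the simplex -/

/-- Sperner's lemma on the grid of points of `ℕ^ι` with coordinate sum `N`: some grid point `p` is,
for each `i` with `p i > |ι|`, within distance `|ι|` of a grid point of label `i`. -/
theorem exists_grid_point {ι : Type*} [Fintype ι] [Nonempty ι] (N : ℕ) (c : (ι → ℕ) → ι) :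
    ∃ p : ι → ℕ, ∑ i, p i = N ∧ ∀ i, p i ≤ Fintype.card ι ∨ ∃ q : ι → ℕ, ∑ j, q j = N ∧
      c q = i ∧ ∀ j, q j ≤ p j + Fintype.card ι ∧ p j ≤ q j + Fintype.card ι := by
  classical
  set n := Fintype.card ι with hn
  let G := {x : ι → ℕ // x ∈ Finset.piAntidiag (Finset.univ : Finset ι) N}
  have hG : ∀ x : G, ∑ i, x.1 i = N := fun x => (Finset.mem_piAntidiag.1 x.2).1
  have hmk : ∀ x : ι → ℕ, ∑ i, x i = N → ∃ y : G, y.1 = x := fun x hx =>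
    ⟨⟨x, Finset.mem_piAntidiag.2 ⟨hx, fun _ _ => Finset.mem_univ _⟩⟩, rfl⟩
  have hGle : ∀ (x : G) i, x.1 i ≤ N := fun x i =>
    (Finset.single_le_sum (f := x.1) (fun _ _ => Nat.zero_le _)
      (Finset.mem_univ i)).trans_eq (hG x)
  obtain ⟨i₁⟩ := ‹Nonempty ι›
  obtain ⟨g, -⟩ := hmk (fun i => if i = i₁ then N else 0) (by simp)
  set B := Fintype.card G
  let e : G ≃ Fin B := Fintype.equivFin G
  let e' : ι ≃ Fin n := Fintype.equivFin ι
  -- The coordinates with ties broken by an enumeration; slack elements are put at the two ends.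
  let r : ι → G ⊕ ι → ℤ := fun i => Sum.elim (fun x => ((x.1 i * B + (e x : ℕ) : ℕ) : ℤ))
    fun j => if j = i then -1 else (((N + 1) * B + (e' j : ℕ) : ℕ) : ℤ)
  have hlt : ∀ (x : G) i, x.1 i * B + (e x : ℕ) < (N + 1) * B := by
    intro x i
    have h1 := (e x).2
    have h2 := Nat.mul_le_mul_right B (hGle x i)
    rw [add_mul, one_mul]
    omega
  have hr : ∀ i, Function.Injective (r i) := by
    rintro i (x | j) (y | k) h
    · simp only [r, Sum.elim_inl, Nat.cast_inj] at h
      congr 1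
      apply e.injective
      apply Fin.ext
      have h' := congrArg (· % B) h
      simpa [Nat.add_mod, Nat.mod_eq_of_lt (e x).2, Nat.mod_eq_of_lt (e y).2] using h'
    · exfalso
      have := hlt x i
      simp only [r, Sum.elim_inl, Sum.elim_inr] at h
      split_ifs at h
      omega
    · exfalso
      have := hlt y i
      simp only [r, Sum.elim_inl, Sum.elim_inr] at h
      split_ifs at h
      omega
    · simp only [r, Sum.elim_inr] at h
      by_cases h1 : j = i <;> by_cases h2 : k = i
      · rw [h1, h2]
      · rw [if_pos h1, if_neg h2] at h
        omega
      · rw [if_neg h1, if_pos h2] at h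
        omega
      · rw [if_neg h1, if_neg h2, Nat.cast_inj] at h
        congr 1
        apply e'.injective
        apply Fin.ext
        omega
  obtain ⟨U, hU, hcU⟩ := exists_dominant_rainbow hr (s := Sum.inr)
    (Sum.elim (fun x : G => c x.1) id) (fun _ => rfl)
    (by
      rintro i (x | j) <;> simp only [r, Sum.elim_inl, Sum.elim_inr, if_true]
      · omega
      · split_ifs <;> omega)
    (by
      rintro i j (x | k) hij hx
      · have := hlt x i
        simp only [r, Sum.elim_inl, Sum.elim_inr, if_neg hij.symm]
        omega
      · exact absurd ⟨k, rfl⟩ hx)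
    ⟨Sum.inl g, by simp⟩
  have hdom : ∀ y : G, ∃ i, Sum.inr i ∉ U ∧ ∀ x : G, Sum.inl x ∈ U → y.1 i ≤ x.1 i := by
    intro y
    obtain ⟨i, hi⟩ := hU (Sum.inl y)
    refine ⟨i, fun h => ?_, fun x hx => ?_⟩
    · have := hi _ h
      simp only [r, Sum.elim_inl, Sum.elim_inr, if_true] at this
      omega
    · have := hi _ hx
      simp only [r, Sum.elim_inl, Nat.cast_le] at this
      by_contra hlt'
      push Not at hlt'
      have h1 := (e x).2
      have h2 := Nat.mul_le_mul_right B (Nat.succ_le_of_lt hlt')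
      rw [Nat.succ_mul] at h2
      omega
  have hcol : ∀ i, Sum.inr i ∉ U → ∃ x : G, Sum.inl x ∈ U ∧ c x.1 = i := by
    intro i hi
    obtain ⟨x | j, hu, hui⟩ := hcU i
    · exact ⟨x, hu, hui⟩
    · simp only [Sum.elim_inr, id] at hui
      exact absurd (hui ▸ hu) hi
  obtain ⟨i₂, hi₂, -⟩ := hdom g
  obtain ⟨p, hpU, -⟩ := hcol i₂ hi₂
  set T : Finset G := Finset.univ.filter fun x => Sum.inl x ∈ U with hT
  have hmT : ∀ i, ∃ m ∈ T, ∀ x ∈ T, m.1 i ≤ x.1 i := fun i =>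
    T.exists_min_image (fun x => x.1 i) ⟨p, by simp [hT, hpU]⟩
  choose m hmT hm using hmT
  set C : Finset ι := Finset.univ.filter fun i => Sum.inr i ∉ U with hC
  have hCn : C.card ≤ n := Finset.card_le_univ C
  -- Otherwise a grid point would exceed the minima of `T` in all coordinates from `C`.
  have hsum : N < ∑ i ∈ C, (m i).1 i + n := by
    by_contra hcon
    push Not at hcon
    have hi₂C : i₂ ∈ C := by simp [hC, hi₂]
    have hle : ∑ i ∈ C, ((m i).1 i + 1) ≤ N := by
      rw [Finset.sum_add_distrib]; simp; omega
    obtain ⟨y, hy⟩ := hmk (fun i => (if i ∈ C then (m i).1 i + 1 else 0) +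
      if i = i₂ then N - ∑ i ∈ C, ((m i).1 i + 1) else 0) (by
        rw [Finset.sum_add_distrib, Finset.sum_ite_mem]
        simp only [Finset.univ_inter, Finset.sum_ite_eq', Finset.mem_univ, if_true]
        omega)
    obtain ⟨i, hi, hi'⟩ := hdom y
    have := hi' (m i) (by simpa [hT] using hmT i)
    rw [hy] at this
    simp [hC, hi] at this
    omega
  have hupper : ∀ x ∈ T, ∀ i, i ∈ C → x.1 i < (m i).1 i + n := by
    intro x hx i hi
    have h1 : ∑ j ∈ C, x.1 j ≤ N :=
      (Finset.sum_le_sum_of_subset (Finset.subset_univ C)).trans_eq (hG x)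
    have h2 : ∑ j ∈ C.erase i, (m j).1 j ≤ ∑ j ∈ C.erase i, x.1 j :=
      Finset.sum_le_sum fun j _ => hm j x hx
    rw [← Finset.add_sum_erase _ _ hi] at h1 hsum
    omega
  have hsmall : ∀ x ∈ T, ∀ i, i ∉ C → x.1 i < n := by
    intro x hx i hi
    have h1 : ∑ j ∈ insert i C, x.1 j ≤ N :=
      (Finset.sum_le_sum_of_subset (Finset.subset_univ _)).trans_eq (hG x)
    have h2 : ∑ j ∈ C, (m j).1 j ≤ ∑ j ∈ C, x.1 j := Finset.sum_le_sum fun j _ => hm j x hx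
    rw [Finset.sum_insert hi] at h1
    omega
  have hclose : ∀ x ∈ T, ∀ y ∈ T, ∀ i, x.1 i ≤ y.1 i + n := by
    intro x hx y hy i
    by_cases hi : i ∈ C
    · have := hupper x hx i hi
      have := hm i y hy
      omega
    · have := hsmall x hx i hi
      omega
  have hpT : p ∈ T := by simp [hT, hpU]
  refine ⟨p.1, hG p, fun i => ?_⟩
  by_cases hi : i ∈ C
  · obtain ⟨q, hqU, hq⟩ := hcol i (by simpa [hC] using hi)
    have hqT : q ∈ T := by simp [hT, hqU]
    exact Or.inr ⟨q.1, hG q, hq, fun j => ⟨hclose q hqT p hpT j, hclose p hpT q hqT j⟩⟩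
  · exact Or.inl (hsmall p hpT i hi).le

/-! ### The theorems of Brouwer and of Knaster, Kuratowski and Mazurkiewicz -/

/-- Brouwer's fixed point theorem for the standard simplex. -/
theorem exists_fixedPoint_stdSimplex {ι : Type*} [Fintype ι] [Nonempty ι]
    {f : (ι → ℝ) → ι → ℝ} (hf : ContinuousOn f (stdSimplex ℝ ι))
    (hmaps : Set.MapsTo f (stdSimplex ℝ ι) (stdSimplex ℝ ι)) :
    ∃ p ∈ stdSimplex ℝ ι, f p = p := by
  classical
  -- As the coordinates of `x` and `f x` have the same sum, they cannot all decrease.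
  have hlabel : ∀ x ∈ stdSimplex ℝ ι, ∃ i, x i ≤ f x i := by
    intro x hx
    by_contra h
    push Not at h
    have := Finset.sum_lt_sum_of_nonempty Finset.univ_nonempty fun i _ => h i
    rw [hx.2, (hmaps hx).2] at this
    exact lt_irrefl _ this
  let sc : ℕ → (ι → ℕ) → ι → ℝ := fun N x i => (x i : ℝ) / (N + 1 : ℕ)
  have hsc : ∀ N (x : ι → ℕ), ∑ i, x i = N + 1 → sc N x ∈ stdSimplex ℝ ι := by
    intro N x hx
    refine ⟨fun i => by positivity, ?_⟩
    simp only [sc]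
    rw [← Finset.sum_div, ← Nat.cast_sum, hx, div_self (by positivity)]
  have hpt : ∀ N : ℕ, ∃ p ∈ stdSimplex ℝ ι, ∀ i, p i ≤ (Fintype.card ι : ℝ) / (N + 1 : ℕ) ∨
      ∃ q ∈ stdSimplex ℝ ι, q i ≤ f q i ∧ dist q p ≤ (Fintype.card ι : ℝ) / (N + 1 : ℕ) := by
    intro N
    have hN : (0 : ℝ) < (N + 1 : ℕ) := by positivity
    obtain ⟨p, hp, hpi⟩ := exists_grid_point (N + 1) fun x : ι → ℕ =>
      if h : ∑ i, x i = N + 1 then (hlabel (sc N x) (hsc N x h)).choose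
      else Classical.arbitrary ι
    refine ⟨sc N p, hsc N p hp, fun i => ?_⟩
    rcases hpi i with h | ⟨q, hq, hqi, hclose⟩
    · left
      simp only [sc]
      gcongr
    · right
      refine ⟨sc N q, hsc N q hq, ?_, ?_⟩
      · rw [dif_pos hq] at hqi
        rw [← hqi]
        exact (hlabel (sc N q) (hsc N q hq)).choose_spec
      · rw [dist_pi_le_iff (by positivity)]
        intro j
        obtain ⟨h1, h2⟩ := hclose j
        have h1' : (q j : ℝ) ≤ p j + Fintype.card ι := by exact_mod_cast h1
        have h2' : (p j : ℝ) ≤ q j + Fintype.card ι := by exact_mod_cast h2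
        simp only [sc, Real.dist_eq]
        rw [← sub_div, abs_div, abs_of_pos hN]
        gcongr
        rw [abs_le]
        constructor <;> linarith
  choose p hp hpi using hpt
  obtain ⟨a, ha, φ, hφ, hlim⟩ := (isCompact_stdSimplex ℝ ι).tendsto_subseq hp
  have hε : Tendsto (fun k => (Fintype.card ι : ℝ) / (φ k + 1 : ℕ)) atTop (𝓝 0) :=
    ((tendsto_const_div_atTop_nhds_zero_nat _).comp (tendsto_add_atTop_nat 1)).comp
      hφ.tendsto_atTop
  have hle : ∀ i, a i ≤ f a i := by
    intro i
    by_contra hlt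
    push Not at hlt
    have hcont : ∀ᶠ q in 𝓝[stdSimplex ℝ ι] a, f q i < q i :=
      ((continuous_apply i).continuousAt.comp_continuousWithinAt (hf a ha)).eventually_lt
        (continuous_apply i).continuousWithinAt hlt
    obtain ⟨δ, hδ, hball⟩ := Metric.mem_nhdsWithin_iff.1 hcont
    have h0 : 0 < a i := lt_of_le_of_lt ((hmaps ha).1 i) hlt
    have e1 : ∀ᶠ k in atTop, (Fintype.card ι : ℝ) / (φ k + 1 : ℕ) < p (φ k) i :=
      hε.eventually_lt (((continuous_apply i).tendsto a).comp hlim) h0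
    have e2 : ∀ᶠ k in atTop, (Fintype.card ι : ℝ) / (φ k + 1 : ℕ) < δ / 2 :=
      hε.eventually_lt_const (half_pos hδ)
    have e3 : ∀ᶠ k in atTop, dist (p (φ k)) a < δ / 2 :=
      (Metric.tendsto_nhds.1 hlim) _ (half_pos hδ)
    obtain ⟨k, h1, h2, h3⟩ := (e1.and (e2.and e3)).exists
    rcases hpi (φ k) i with h | ⟨q, hq, hqi, hqp⟩
    · exact absurd h (not_le.2 h1)
    · have hd : dist q a < δ := by
        have := dist_triangle q (p (φ k)) a
        linarith
      exact absurd hqi (not_le.2 (hball ⟨hd, hq⟩))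
  refine ⟨a, ha, ?_⟩
  have := (Finset.sum_eq_sum_iff_of_le fun i (_ : i ∈ Finset.univ) => hle i).1
    (by rw [ha.2, (hmaps ha).2])
  exact funext fun i => (this i (Finset.mem_univ i)).symm

/-- The Knaster–Kuratowski–Mazurkiewicz theorem. If the intersection were empty, the normalized
distances to the sets `C i` would define a self-map of the simplex, whose fixed point would
contradict the covering hypothesis. -/
theorem nonempty_iInter_of_convexHull_subset {E : Type*} [NormedAddCommGroup E]
    [NormedSpace ℝ E] {ι : Type*} [Fintype ι] [Nonempty ι] (x : ι → E) {C : ι → Set E}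
    (hC : ∀ i, IsClosed (C i))
    (hcover : ∀ L : Finset ι, ∀ z ∈ convexHull ℝ (x '' (L : Set ι)), ∃ i ∈ L, z ∈ C i) :
    (⋂ i, C i).Nonempty := by
  classical
  have hCne : ∀ i, (C i).Nonempty := by
    intro i
    obtain ⟨j, hj, hz⟩ := hcover {i} (x i) (subset_convexHull ℝ _ (by simp))
    rw [Finset.mem_singleton.1 hj] at hz
    exact ⟨_, hz⟩
  by_contra hemp
  let z : (ι → ℝ) → E := fun p => ∑ i, p i • x i
  have hz : Continuous z := by fun_prop
  let g : ι → (ι → ℝ) → ℝ := fun i p => Metric.infDist (z p) (C i)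
  have hg : ∀ i, Continuous (g i) := fun i => (Metric.continuous_infDist_pt _).comp hz
  have hg0 : ∀ i p, 0 ≤ g i p := fun i p => Metric.infDist_nonneg
  have hgpos : ∀ i p, 0 < g i p ↔ z p ∉ C i := fun i p =>
    ((hC i).notMem_iff_infDist_pos (hCne i)).symm
  have hS : ∀ p, 0 < ∑ i, g i p := by
    intro p
    obtain ⟨i, hi⟩ : ∃ i, z p ∉ C i := by
      by_contra h
      push Not at h
      exact hemp ⟨z p, Set.mem_iInter.2 h⟩
    exact Finset.sum_pos' (fun i _ => hg0 i p) ⟨i, Finset.mem_univ i, (hgpos i p).2 hi⟩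
  obtain ⟨p, hp, hfp⟩ := exists_fixedPoint_stdSimplex (ι := ι)
    (f := fun p i => g i p / ∑ j, g j p)
    (Continuous.continuousOn (continuous_pi fun i => (hg i).div
      (continuous_finsetSum _ fun j _ => hg j) fun p => (hS p).ne'))
    (fun p _ => ⟨fun i => div_nonneg (hg0 i p) (hS p).le, by
      rw [← Finset.sum_div, div_self (hS p).ne']⟩)
  -- The point `z p` lies in the face spanned by the indices `i` with `z p ∉ C i`.
  have hiff : ∀ i, p i ≠ 0 → z p ∉ C i := by
    intro i hi
    rw [← hgpos i p]
    refine lt_of_le_of_ne (hg0 i p) fun h => hi ?_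
    rw [← congrFun hfp i, ← h, zero_div]
  have hmem : z p ∈ convexHull ℝ
      (x '' ((Finset.univ.filter fun i => p i ≠ 0 : Finset ι) : Set ι)) := by
    have hzp : z p = ∑ i ∈ Finset.univ.filter (fun i => p i ≠ 0), p i • x i := by
      refine (Finset.sum_subset (Finset.filter_subset _ _) fun i _ hi => ?_).symm
      have : p i = 0 := by simpa using hi
      rw [this, zero_smul]
    rw [hzp]
    refine (convex_convexHull ℝ _).sum_mem (fun i _ => hp.1 i) ?_ fun i hi =>
      subset_convexHull ℝ _ (Set.mem_image_of_mem x hi)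
    rw [Finset.sum_filter_ne_zero, hp.2]
  obtain ⟨i, hi, hzi⟩ := hcover _ _ hmem
  exact hiff i (Finset.mem_filter.1 hi).2 hzi

/-! ### Solutions on compact sets -/

section Compact

/-- Transfer upper semicontinuity makes the intersection of the sets `{ψ (·, y) ≥ 0}` equal to
that of their closures, so on a compact set finite intersections of the closures decide. -/
theorem nonempty_solutionSet_of_isCompact {X : Type*} [σ : TopologicalSpace X] [T2Space X]
    {A : Set X} (hA : IsCompact A) (hne : A.Nonempty) {ψ : X → X → ℝ}
    (htusc : TransferUSCOn σ A ψ)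
    (hfin : ∀ s : Finset X, s.Nonempty → (s : Set X) ⊆ A →
      (⋂ y ∈ s, closure {x | x ∈ A ∧ 0 ≤ ψ x y}).Nonempty) :
    (solutionSet ψ A).Nonempty := by
  classical
  obtain ⟨x, hxA, hx⟩ := hA.inter_iInter_nonempty
    (fun y : A => closure {x | x ∈ A ∧ 0 ≤ ψ x y}) (fun _ => isClosed_closure) (by
      intro u
      rcases u.eq_empty_or_nonempty with rfl | hu
      · simpa using hne
      obtain ⟨x, hx⟩ := hfin (u.image Subtype.val) (hu.image _) (by
        intro y hy
        obtain ⟨y, -, rfl⟩ := Finset.mem_image.1 (Finset.mem_coe.1 hy)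
        exact y.2)
      have hx' : ∀ y ∈ u, x ∈ closure {x | x ∈ A ∧ 0 ≤ ψ x (y : X)} := fun y hy =>
        Set.mem_iInter₂.1 hx _ (Finset.mem_image_of_mem _ hy)
      obtain ⟨y, hy⟩ := hu
      exact ⟨x, closure_minimal (fun _ h => h.1) hA.isClosed (hx' y hy),
        Set.mem_iInter₂.2 hx'⟩)
  refine ⟨x, hxA, fun y hy => ?_⟩
  by_contra hneg
  obtain ⟨y', hy', hev⟩ := htusc x hxA y hy (by simpa using hneg)
  have hcl := Set.mem_iInter.1 hx ⟨y', hy'⟩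
  rw [mem_closure_iff_frequently] at hcl
  obtain ⟨z, ⟨hzA, hz⟩, hz'⟩ := (hcl.and_eventually (eventually_nhdsWithin_iff.1 hev)).exists
  have := hz' hzA
  simp only [Pi.neg_apply] at this
  linarith

/-- If a sequence returns infinitely often to a compact member of a monotone exhaustion and is
eventually a solution against each single `y`, then its cluster points are solutions. -/
theorem exists_solution_of_frequently {X : Type*} [σ : TopologicalSpace X] {A : ℕ → Set X}
    (hA : Monotone A) {ψ : X → X → ℝ} (htusc : ∀ n, 1 ≤ n → TransferUSCOn σ (A n) ψ)
    {N : ℕ} (hN : IsCompact (A N)) {v : ℕ → X} (hv : ∃ᶠ k in atTop, v k ∈ A N)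
    (hψ : ∀ n, ∀ y ∈ A n, ∀ᶠ k in atTop, 0 ≤ ψ (v k) y) :
    ∃ w ∈ A N, ∀ n, ∀ y ∈ A n, 0 ≤ ψ w y := by
  have hF : (atTop ⊓ 𝓟 {k | v k ∈ A N}).NeBot := frequently_mem_iff_neBot.1 hv
  obtain ⟨w, hwN, hw⟩ := hN (f := map v (atTop ⊓ 𝓟 {k | v k ∈ A N})) (by
    rw [le_principal_iff, mem_map]
    exact mem_inf_of_right (mem_principal_self _))
  refine ⟨w, hwN, fun n y hy => ?_⟩
  by_contra hneg
  set M := max (max N n) 1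
  have hNM : N ≤ M := (le_max_left _ _).trans (le_max_left _ _)
  have hnM : n ≤ M := (le_max_right _ _).trans (le_max_left _ _)
  obtain ⟨y', hy', hev⟩ := htusc M (le_max_right _ _) w (hA hNM hwN) y (hA hnM hy)
    (by simpa using hneg)
  have h1 : ∀ᶠ x in map v (atTop ⊓ 𝓟 {k | v k ∈ A N}), x ∈ A M ∧ 0 ≤ ψ x y' := by
    rw [eventually_map, eventually_inf_principal]
    filter_upwards [hψ M y' hy'] with k hk hkN using ⟨hA hNM hkN, hk⟩
  obtain ⟨x, ⟨hxA, hxψ⟩, hx⟩ := ((ClusterPt.frequently' hw h1).and_eventually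
    (eventually_nhdsWithin_iff.1 hev)).exists
  have := hx hxA
  simp only [Pi.neg_apply] at this
  linarith

end Compact

section Bifunction

variable {X : Type*}

/-- If no point dominates a finite set, its points can be followed along negative values of `ψ`
until a cycle closes up. -/
theorem CyclicallyAntiQuasimonotone.antiLocallyDominated {K A : Set X} {ψ : X → X → ℝ}
    (h : CyclicallyAntiQuasimonotone K ψ) (hAK : A ⊆ K) : AntiLocallyDominated A A ψ := by
  intro s hs hsA
  by_contra hcon
  push Not at hcon
  have hg : ∀ x : s, ∃ y : s, ψ x y < 0 := by
    intro x
    obtain ⟨y, hy, hxy⟩ := hcon x (hsA x.2)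
    exact ⟨⟨y, hy⟩, by simpa using hxy⟩
  choose g hg using hg
  obtain ⟨a, ha⟩ := hs
  obtain ⟨n, m, hnm, heq⟩ : ∃ n m, n < m ∧ g^[n] ⟨a, ha⟩ = g^[m] ⟨a, ha⟩ := by
    obtain ⟨n, m, hne, heq⟩ := Finite.exists_ne_map_eq_of_infinite fun n => g^[n] ⟨a, ha⟩
    rcases hne.lt_or_gt with h | h
    · exact ⟨n, m, h, heq⟩
    · exact ⟨m, n, h, heq.symm⟩
  set b := g^[n] ⟨a, ha⟩ with hb
  obtain ⟨p, hp⟩ : ∃ p, m = p + 1 + n := ⟨m - n - 1, by omega⟩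
  have hper : Function.IsPeriodicPt g (p + 1) b := by
    rw [Function.IsPeriodicPt, Function.IsFixedPt, hb, ← Function.iterate_add_apply, ← hp, ← heq]
  obtain ⟨i, hi⟩ := h p (fun i => (g^[(i : ℕ)] b : X)) fun i => hAK (hsA (g^[(i : ℕ)] b).2)
  have hmod : g^[((i + 1 : Fin (p + 1)) : ℕ)] b = g (g^[(i : ℕ)] b) := by
    rw [← Function.iterate_succ_apply' g, ← hper.iterate_mod_apply (i + 1)]
    congr 2
    simp [Fin.val_add]
  rw [hmod] at hi
  exact absurd hi (not_le.2 (hg _))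

end Bifunction

section Normed

variable {X : Type*} [NormedAddCommGroup X]

theorem trunc_mono (K : Set X) : Monotone (trunc K) := fun _ _ hmn _ hx =>
  ⟨hx.1, hx.2.trans (Nat.cast_le.2 hmn)⟩

theorem exists_mem_trunc {K : Set X} {x : X} (hx : x ∈ K) : ∃ n, x ∈ trunc K n :=
  (exists_nat_ge ‖x‖).imp fun _ hn => ⟨hx, hn⟩

theorem trunc_eq_inter (K : Set X) (n : ℕ) : trunc K n = K ∩ Metric.closedBall 0 n := by
  ext x
  simp [trunc]

/-- Solutions on the truncations are eventually solutions against each single point of `K`. -/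
theorem eventually_nonneg_of_mem_solutionSet_trunc {K : Set X} {ψ : X → X → ℝ} {x : ℕ → X}
    (hx : ∀ n, 1 ≤ n → (trunc K n).Nonempty → x n ∈ solutionSet ψ (trunc K n)) {y : X}
    (hy : y ∈ K) : ∀ᶠ n in atTop, y ∈ trunc K n ∧ x n ∈ K ∧ 0 ≤ ψ (x n) y := by
  obtain ⟨m, hm⟩ := exists_mem_trunc hy
  filter_upwards [eventually_ge_atTop m, eventually_ge_atTop 1] with n hmn hn
  have hyn := trunc_mono K hmn hm
  have := hx n hn ⟨y, hyn⟩
  exact ⟨hyn, this.1.1, this.2 y hyn⟩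

variable [NormedSpace ℝ X]

theorem transferQuasiconvex_of_quasiconvexOn {K A : Set X} {ψ : X → X → ℝ} (hAK : A ⊆ K)
    (hA : Convex ℝ A) (hψ : ∀ x ∈ K, QuasiconvexOn ℝ K fun y => ψ x y)
    (hdiag : ∀ x ∈ K, 0 ≤ ψ x x) : TransferQuasiconvex A A ψ := by
  refine fun m y hy => ⟨y, hy, fun L z hz => ?_⟩
  by_contra hcon
  push Not at hcon
  have hsub : y '' (L : Set (Fin m)) ⊆ A := by
    rintro _ ⟨i, -, rfl⟩
    exact hy i
  have hzK : z ∈ K := hAK (convexHull_min hsub hA hz)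
  have hlt := convexHull_min (t := {x | x ∈ K ∧ ψ z x < 0}) (by
    rintro _ ⟨i, hi, rfl⟩
    exact ⟨hAK (hy i), by simpa using hcon i hi⟩) ((hψ z hzK).convex_lt 0) hz
  exact absurd (hdiag z hzK) (not_le.2 hlt.2)

theorem transferQuasiconvex_of_pseudomonotone {K A : Set X} {ψ : X → X → ℝ} (hAK : A ⊆ K)
    (hA : Convex ℝ A) (hmon : Pseudomonotone K (-ψ))
    (hψ : ∀ y ∈ K, QuasiconcaveOn ℝ K fun x => ψ x y)
    (hdiag : ∀ x ∈ K, ψ x x = 0) : TransferQuasiconvex A A ψ := by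
  refine fun m y hy => ⟨y, hy, fun L z hz => ?_⟩
  by_contra hcon
  push Not at hcon
  have hsub : y '' (L : Set (Fin m)) ⊆ A := by
    rintro _ ⟨i, -, rfl⟩
    exact hy i
  have hzK : z ∈ K := hAK (convexHull_min hsub hA hz)
  -- By pseudomonotonicity `ψ z (y i) < 0` forces `0 < ψ (y i) z`.
  have hlt := convexHull_min (t := {x | x ∈ K ∧ 0 < ψ x z}) (by
    rintro _ ⟨i, hi, rfl⟩
    refine ⟨hAK (hy i), ?_⟩
    by_contra hle
    have h1 := hmon _ (hAK (hy i)) z hzK (by simpa using hle)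
    exact absurd h1 (not_le.2 (hcon i hi))) ((hψ z hzK).convex_gt 0) hz
  exact absurd (hdiag z hzK) hlt.2.ne'

theorem AntiLocallyDominated.nonempty_solutionSet {X : Type*} {σ : TopologicalSpace X}
    (hT2 : @T2Space X σ) {A : Set X} (hA : @IsCompact X σ A) (hne : A.Nonempty)
    {ψ : X → X → ℝ} (htusc : TransferUSCOn σ A ψ) (h : AntiLocallyDominated A A ψ) :
    (solutionSet ψ A).Nonempty := by
  refine nonempty_solutionSet_of_isCompact hA hne htusc fun s hs hsA => ?_
  obtain ⟨x, hxA, hx⟩ := h s hs hsA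
  exact ⟨x, Set.mem_iInter₂.2 fun y hy => subset_closure ⟨hxA, by simpa using hx y hy⟩⟩

/-- The sets `{ψ (·, y) ≥ 0}` have `σ`-closures that are closed in norm, so the
Knaster–Kuratowski–Mazurkiewicz theorem applies to them although `σ` need not be a vector
topology. -/
theorem TransferQuasiconvex.nonempty_solutionSet {σ : TopologicalSpace X}
    (hT2 : @T2Space X σ)
    (hσ : (UniformSpace.toTopologicalSpace : TopologicalSpace X) ≤ σ)
    {A : Set X} (hA : @IsCompact X σ A) (hconv : Convex ℝ A) (hne : A.Nonempty)
    {ψ : X → X → ℝ} (htusc : TransferUSCOn σ A ψ) (h : TransferQuasiconvex A A ψ) :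
    (solutionSet ψ A).Nonempty := by
  refine @nonempty_solutionSet_of_isCompact X σ hT2 A hA hne ψ htusc fun s hs hsA => ?_
  have : Nonempty (Fin s.card) := ⟨⟨0, hs.card_pos⟩⟩
  let y : Fin s.card → X := fun i => s.equivFin.symm i
  obtain ⟨x, hxA, hx⟩ := h s.card y fun i => hsA (s.equivFin.symm i).2
  obtain ⟨z, hz⟩ := nonempty_iInter_of_convexHull_subset x
    (C := fun i => @closure X σ {x | x ∈ A ∧ 0 ≤ ψ x (y i)})
    (fun i => (@isClosed_closure X σ _).mono hσ) (by
      intro L z hz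
      obtain ⟨i, hi, hzi⟩ := hx L z hz
      refine ⟨i, hi, @subset_closure X σ _ z ⟨?_, by simpa using hzi⟩⟩
      refine convexHull_min ?_ hconv hz
      rintro _ ⟨j, -, rfl⟩
      exact hxA j)
  refine ⟨z, Set.mem_iInter₂.2 fun w hw => ?_⟩
  have := Set.mem_iInter.1 hz (s.equivFin ⟨w, hw⟩)
  simpa [y] using this

theorem convex_trunc {K : Set X} (hK : Convex ℝ K) (n : ℕ) : Convex ℝ (trunc K n) := by
  rw [trunc_eq_inter]
  exact hK.inter (convex_closedBall _ _)

theorem isCompact_trunc {σ : TopologicalSpace X}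
    (hσ_smul : ∀ c : ℝ, @Continuous X X σ σ fun x => c • x)
    (hB : @IsCompact X σ (Metric.closedBall (0 : X) 1))
    {K : Set X} (hK : @IsClosed X σ K) (n : ℕ) : @IsCompact X σ (trunc K n) := by
  have h := @IsCompact.image X X σ σ _ _ hB (hσ_smul n)
  have hball : (fun x : X => (n : ℝ) • x) '' Metric.closedBall 0 1 = Metric.closedBall 0 n := by
    rw [Set.image_smul, smul_unitClosedBall_of_nonneg n.cast_nonneg]
  rw [hball] at h
  rw [trunc_eq_inter]
  exact @IsCompact.inter_left X σ _ _ h hK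

/-! ### Asymptotic cones -/

theorem asympCone_mono (σ : TopologicalSpace X) {A B : Set X} (h : A ⊆ B) :
    asympCone σ A ⊆ asympCone σ B := fun _ ⟨t, x, ht, ht', hx, hlim⟩ =>
  ⟨t, x, ht, ht', fun k => h (hx k), hlim⟩

theorem mem_asympCone_of_eventually {σ : TopologicalSpace X} {A : Set X} {u : X} {t : ℕ → ℝ}
    {x : ℕ → X} (ht : ∀ k, 0 < t k) (ht' : Tendsto t atTop atTop) (hx : ∀ᶠ k in atTop, x k ∈ A)
    (hlim : Tendsto (fun k => (t k)⁻¹ • x k) atTop (@nhds X σ u)) : u ∈ asympCone σ A := by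
  obtain ⟨N, hN⟩ := eventually_atTop.1 hx
  exact ⟨fun k => t (k + N), fun k => x (k + N), fun k => ht _,
    ht'.comp (tendsto_add_atTop_nat N), fun k => hN _ (Nat.le_add_left _ _),
    hlim.comp (tendsto_add_atTop_nat N)⟩

theorem tendsto_inv_natCast_add_one_smul (a : X) :
    Tendsto (fun k : ℕ => ((k : ℝ) + 1)⁻¹ • a) atTop (𝓝 0) := by
  have ht : Tendsto (fun k : ℕ => (k : ℝ) + 1) atTop atTop :=
    tendsto_atTop_add_const_right _ _ tendsto_natCast_atTop_atTop
  simpa using (tendsto_inv_atTop_zero.comp ht).smul_const a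

theorem zero_mem_asympCone {σ : TopologicalSpace X}
    (hσ : (UniformSpace.toTopologicalSpace : TopologicalSpace X) ≤ σ) {A : Set X}
    (hA : A.Nonempty) : (0 : X) ∈ asympCone σ A := by
  obtain ⟨a, ha⟩ := hA
  exact ⟨fun k => k + 1, fun _ => a, fun k => by positivity,
    tendsto_atTop_add_const_right _ _ tendsto_natCast_atTop_atTop, fun _ => ha,
    (tendsto_inv_natCast_add_one_smul a).mono_right (_root_.nhds_mono hσ)⟩

/-- Only the level `0` of the generalized asymptotic functions is needed. -/
theorem mem_RSet {σ : TopologicalSpace X} {K : Set X} {ψ : X → X → ℝ} {u : X}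
    (hu : u ∈ asympCone σ K) (h : ∀ y ∈ K, u ∈ asympCone σ {x | x ∈ K ∧ 0 ≤ ψ x y}) :
    u ∈ RSet σ K ψ := by
  refine ⟨hu, fun y hy => ?_⟩
  refine (iInf₂_le (0 : ℝ) ?_).trans EReal.coe_zero.le
  refine asympCone_mono σ ?_ (h y hy)
  rintro x ⟨hxK, hx⟩
  simp only [extendTop, if_pos hxK, Set.mem_ofPred_eq]
  exact_mod_cast neg_nonpos.2 hx

theorem asympCone_solutionSet_subset_RSet (σ : TopologicalSpace X) (K : Set X)
    (ψ : X → X → ℝ) : asympCone σ (solutionSet ψ K) ⊆ RSet σ K ψ := by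
  have hsub : ∀ y ∈ K, solutionSet ψ K ⊆ {x | x ∈ K ∧ 0 ≤ ψ x y} :=
    fun y hy _ hx => ⟨hx.1, hx.2 y hy⟩
  exact fun _ hu => mem_RSet (asympCone_mono σ (fun _ hx => hx.1) hu) fun y hy =>
    asympCone_mono σ (hsub y hy) hu

/-! ### Solutions on unbounded sets -/

/-- Solutions on the truncations yield a solution on `K` when `R_σ^E ⊆ {0}`. -/
theorem nonempty_solutionSet_of_trunc {σ : TopologicalSpace X} {K : Set X} (hK : K.Nonempty)
    {ψ : X → X → ℝ} (hcomp : ∀ n, @IsCompact X σ (trunc K n)) (hψK : ConditionK σ K ψ)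
    (htusc : ∀ n, 1 ≤ n → TransferUSCOn σ (trunc K n) ψ) (hR : RSet σ K ψ ⊆ {0})
    (hsol : ∀ n, 1 ≤ n → (trunc K n).Nonempty → (solutionSet ψ (trunc K n)).Nonempty) :
    (solutionSet ψ K).Nonempty := by
  -- It suffices to find a sequence in `K` without `‖v k‖ → ∞` that solves against each `y`.
  have hcluster : ∀ v : ℕ → X, (∀ᶠ k in atTop, v k ∈ K) → (∃ C : ℝ, ∃ᶠ k in atTop, ‖v k‖ ≤ C) →
      (∀ y ∈ K, ∀ᶠ k in atTop, 0 ≤ ψ (v k) y) → (solutionSet ψ K).Nonempty := by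
    rintro v hvK ⟨C, hC⟩ hv
    obtain ⟨N, hN⟩ := exists_nat_ge C
    obtain ⟨w, hwN, hw⟩ := exists_solution_of_frequently (trunc_mono K) htusc (hcomp N)
      ((hC.and_eventually hvK).mono fun k hk => ⟨hk.2, hk.1.trans hN⟩)
      fun n y hy => hv y hy.1
    refine ⟨w, hwN.1, fun y hy => ?_⟩
    obtain ⟨n, hn⟩ := exists_mem_trunc hy
    exact hw n y hn
  obtain ⟨x, hx⟩ : ∃ x : ℕ → X, ∀ n, 1 ≤ n → (trunc K n).Nonempty →
      x n ∈ solutionSet ψ (trunc K n) := by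
    have : ∀ n, ∃ z, 1 ≤ n → (trunc K n).Nonempty → z ∈ solutionSet ψ (trunc K n) := by
      intro n
      by_cases h : 1 ≤ n ∧ (trunc K n).Nonempty
      · exact (hsol n h.1 h.2).imp fun z hz _ _ => hz
      · exact ⟨0, fun h1 h2 => absurd ⟨h1, h2⟩ h⟩
    choose x hx using this
    exact ⟨x, hx⟩
  obtain ⟨y₀, hy₀⟩ := hK
  by_cases hbdd : ∀ C : ℝ, ∃ n, C < ‖x n‖
  · obtain ⟨φ, w, d, hφ, -, hw, hd, hdK, hψw, hlim⟩ := hψK x hx hbdd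
    have hwψ : ∀ y ∈ K, ∀ᶠ k in atTop, 0 ≤ ψ (w k) y := fun y hy =>
      (hφ.tendsto_atTop.eventually (eventually_nonneg_of_mem_solutionSet_trunc hx hy)).mono
        fun k hk => hk.2.2.trans (hψw k y hk.1)
    by_cases htop : Tendsto (fun k => ‖w k‖) atTop atTop
    · -- The direction `d` of an escaping sequence would be a nonzero element of `R_σ^E`.
      refine absurd (hR (mem_RSet hdK fun y hy => ?_)) hd
      exact mem_asympCone_of_eventually (fun k => norm_pos_iff.2 (hw k).2) htop
        ((hwψ y hy).mono fun k hk => ⟨(hw k).1, hk⟩) hlim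
    · rw [tendsto_atTop] at htop
      push Not at htop
      obtain ⟨C, hC⟩ := htop
      exact hcluster w (Eventually.of_forall fun k => (hw k).1)
        ⟨C, hC.mono fun k hk => hk.le⟩ hwψ
  · push Not at hbdd
    obtain ⟨C, hC⟩ := hbdd
    exact hcluster x ((eventually_nonneg_of_mem_solutionSet_trunc hx hy₀).mono fun n hn => hn.2.1)
      ⟨C, Frequently.of_forall hC⟩
      fun y hy => (eventually_nonneg_of_mem_solutionSet_trunc hx hy).mono fun n hn => hn.2.2

end Normed

end EquilibriumProblem

theorem mainTheorem2 {X : Type*} [NormedAddCommGroup X] [NormedSpace ℝ X]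
    (σ : TopologicalSpace X)
    (hσ_hausdorff : @T2Space X σ)
    (hσ_coarser : (UniformSpace.toTopologicalSpace : TopologicalSpace X) ≤ σ)
    (hσ_smul : ∀ c : ℝ, @Continuous X X σ σ fun x => c • x)
    (hH : EquilibriumProblem.AssumptionH X σ)
    (hB : @IsCompact X σ (Metric.closedBall (0 : X) 1))
    (K : Set X) (hK_ne : K.Nonempty) (hK_closed : @IsClosed X σ K) (hK_convex : Convex ℝ K)
    (ψ : X → X → ℝ)
    (hψK : EquilibriumProblem.ConditionK σ K ψ)
    (hψ_tusc : ∀ n : ℕ, 1 ≤ n →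
      EquilibriumProblem.TransferUSCOn σ (EquilibriumProblem.trunc K n) ψ)
    (hR : EquilibriumProblem.RSet σ K ψ ⊆ {0})
    (hcases :
      (∀ n : ℕ, 1 ≤ n → EquilibriumProblem.AntiLocallyDominated
        (EquilibriumProblem.trunc K n) (EquilibriumProblem.trunc K n) ψ) ∨
      (∀ n : ℕ, 1 ≤ n → EquilibriumProblem.TransferQuasiconvex
        (EquilibriumProblem.trunc K n) (EquilibriumProblem.trunc K n) ψ) ∨
      EquilibriumProblem.CyclicallyAntiQuasimonotone K ψ ∨
      ((∀ x ∈ K, QuasiconvexOn ℝ K fun y => ψ x y) ∧ ∀ x ∈ K, 0 ≤ ψ x x) ∨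
      (EquilibriumProblem.Pseudomonotone K (-ψ) ∧
        (∀ y ∈ K, QuasiconcaveOn ℝ K fun x => ψ x y) ∧ ∀ x ∈ K, ψ x x = 0)) :
    (EquilibriumProblem.solutionSet ψ K).Nonempty ∧
      EquilibriumProblem.asympCone σ (EquilibriumProblem.solutionSet ψ K) = {0} := by
  have hcomp := EquilibriumProblem.isCompact_trunc hσ_smul hB hK_closed
  have hsub : ∀ n, EquilibriumProblem.trunc K n ⊆ K := fun n _ hx => hx.1
  have hconv := EquilibriumProblem.convex_trunc hK_convex
  have hsol : ∀ n, 1 ≤ n → (EquilibriumProblem.trunc K n).Nonempty →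
      (EquilibriumProblem.solutionSet ψ (EquilibriumProblem.trunc K n)).Nonempty := by
    intro n hn hne
    have hdom := EquilibriumProblem.AntiLocallyDominated.nonempty_solutionSet
      hσ_hausdorff (hcomp n) hne (hψ_tusc n hn)
    have hquasi := EquilibriumProblem.TransferQuasiconvex.nonempty_solutionSet
      hσ_hausdorff hσ_coarser (hcomp n) (hconv n) hne (hψ_tusc n hn)
    rcases hcases with h | h | h | ⟨h, hdiag⟩ | ⟨hmon, h, hdiag⟩
    · exact hdom (h n hn)
    · exact hquasi (h n hn)
    · exact hdom (h.antiLocallyDominated (hsub n))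
    · exact hquasi (EquilibriumProblem.transferQuasiconvex_of_quasiconvexOn (hsub n) (hconv n)
        h hdiag)
    · exact hquasi (EquilibriumProblem.transferQuasiconvex_of_pseudomonotone (hsub n) (hconv n)
        hmon h hdiag)
  have hne := EquilibriumProblem.nonempty_solutionSet_of_trunc hK_ne hcomp hψK hψ_tusc hR hsol
  refine ⟨hne, Set.Subset.antisymm ?_ ?_⟩
  · exact (EquilibriumProblem.asympCone_solutionSet_subset_RSet σ K ψ).trans hR
  · exact Set.singleton_subset_iff.2 (EquilibriumProblem.zero_mem_asympCone hσ_coarser hne)
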